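/- Write $\mathfrak H$ for the complex upper half-plane, $D=\frac1{2\pi i}\frac{d}{d\tau}$, $(x)_s=x(x+1)\cdots(x+s-1)$, $\binom xs=\frac{x(x-1)\cdots(x-s+1)}{s!}$, $E_2=1-24\sum_{j\ge1}\bigl(\sum_{d\mid j}d\bigr)e^{2\pi i j\tau}$, and $(f|_k\gamma)(\tau)=(c\tau+d)^{-k}f\bigl(\frac{a\tau+b}{c\tau+d}\bigr)$ for $k\in\mathbb C$ and $\gamma=\begin{pmatrix}a&b\\c&d\end{pmatrix}\in SL_2(\mathbb Z)$ (with the principal branch of the power). For functions $f,g$ holomorphic in $\mathfrak H$, $k,\ell\in\mathbb C$ and $n\ge0$ let $$[f,g]_n^{(k,\ell)}=\sum_{i=0}^n(-1)^i\binom{n+k-1}{n-i}\binom{n+\ell-1}{i}\,D^i(f)\,D^{n-i}(g)$$ be the Rankin--Cohen bracket, put $[f,g]_{-1}^{(k,\ell)}=0$, and let $$\mathrm K_k^n(f)=D^n(f)-\frac{k+n-1}{12}\,[E_2,f]_{n-1}^{(2,k)}$$ be the Kaneko--Koike operator. A modular linear differential operator (MLDO) of type $(k,l)$ on $SL_2(\mathbb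 Z)$, where $k,l\in\mathbb C$, is a linear differential operator $L=\sum_r a_r(\tau)D^r$ of finite order whose coefficients $a_r$ are holomorphic in $\mathfrak H$ and bounded as $\operatorname{Im}\tau\to\infty$ and which satisfies $L(f|_k\gamma)=L(f)|_l\gamma$ for all holomorphic functions $f$ in $\mathfrak H$ and all $\gamma\in SL_2(\mathbb Z)$. **Theorem.** Let $k\in\mathbb C$, let $n\ge0$ be an integer, and let $L=\sum_{r=0}^n a_r(\tau)D^r$ be a monic ($a_n=1$) MLDO of order $n$ and type $(k,k+2n)$ on the full modular group $SL_2(\mathbb Z)$. Then for every integer $m$ with $0\le m\le n-2$ the function $$h_m=\sum_{s=0}^{n-m}\binom{m+s}{s}\,\frac{(k+m)_s}{(2n-2m-s-1)_s}\,D^s(a_{m+s})$$ is a (holomorphic) modular form of weight $2n-2m$ on $SL_2(\mathbb Z)$, and for every holomorphic function $f$ in $\mathfrak H$ $$L(f)=\mathrm K_k^n(f)+\sum_{m=0}^{n-2}\binom{2n-m-1}{m}^{-1}\,[h_m,f]_m^{(2n-2m,\,k)}.$$ -/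

import Mathlib

open UpperHalfPlane ModularForm EisensteinSeries Derivative
open scoped Manifold MatrixGroups

noncomputable section

namespace MLDO

/-- The slash operator `(f|_k γ)(τ) = (cτ+d)^{-k} f(γτ)` of complex weight `k` for `γ ∈ SL₂(ℤ)`,
the power being taken with the principal branch (no choice is involved if `k` is an integer). -/
def slash (k : ℂ) (γ : SL(2, ℤ)) (f : ℍ → ℂ) (τ : ℍ) : ℂ :=
  (denom γ τ) ^ (-k) * f (γ • τ)

/-- A linear differential operator `∑_r a_r(τ) D^r` of finite order on the upper half-plane with
holomorphic coefficients, where `D = (2πi)⁻¹ d/dτ`; it is given by its coefficients `a_r`. -/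
structure DiffOp where
  coeff : ℕ →₀ (ℍ → ℂ)
  holomorphic : ∀ r, MDiff (coeff r)

/-- The action of `L = ∑_r a_r D^r` on functions. -/
def DiffOp.apply (L : DiffOp) (f : ℍ → ℂ) (τ : ℍ) : ℂ :=
  L.coeff.sum fun r a => a τ * (normalizedDerivOfComplex^[r] f) τ

/-- `L` is a modular linear differential operator of type `(k, l)` on `SL₂(ℤ)` (so its weight is
`l - k`): the coefficients are holomorphic also at the cusp, and `L(f|_k γ) = L(f)|_l γ` for all
holomorphic functions `f` in the upper half-plane and all `γ ∈ SL₂(ℤ)`. -/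
structure DiffOp.IsModular (L : DiffOp) (k l : ℂ) : Prop where
  bounded : ∀ r, IsBoundedAtImInfty (L.coeff r)
  equivariant : ∀ f : ℍ → ℂ, MDiff f → ∀ γ : SL(2, ℤ),
    L.apply (slash k γ f) = slash l γ (L.apply f)

/-- `L = D^n + (lower order terms)`. -/
def DiffOp.IsMonicOfOrder (L : DiffOp) (n : ℕ) : Prop :=
  L.coeff n = 1 ∧ ∀ r, n < r → L.coeff r = 0

/-- The Rankin-Cohen bracket `[f, g]_n^{(k, l)}`. -/
def rankinCohen (k l : ℂ) (n : ℕ) (f g : ℍ → ℂ) (τ : ℍ) : ℂ :=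
  ∑ i ∈ Finset.range (n + 1),
    (-1) ^ i * Ring.choose ((n : ℂ) + k - 1) (n - i) * Ring.choose ((n : ℂ) + l - 1) i *
      (normalizedDerivOfComplex^[i] f) τ * (normalizedDerivOfComplex^[n - i] g) τ

/-- The Kaneko-Koike operator
`K_k^n(f) = D^n f - (k+n-1)/12 * [E₂, f]_{n-1}^{(2, k)}`, where `[·,·]_{-1} = 0`. -/
def kanekoKoike (k : ℂ) : ℕ → (ℍ → ℂ) → ℍ → ℂ
  | 0, f, τ => f τ
  | n + 1, f, τ => (normalizedDerivOfComplex^[n + 1] f) τ -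
      (k + n) / 12 * rankinCohen 2 k n E2 f τ

/-- The function `h_m = ∑_{s=0}^{n-m} C(m+s, s) (k+m)_s / (K-2m-s-1)_s D^s a_{m+s}` attached to an
operator `∑_{r ≤ n} a_r D^r` of type `(k, k+K)`, where `(x)_s = x(x+1)⋯(x+s-1)`. -/
def DiffOp.h (L : DiffOp) (k K : ℂ) (n m : ℕ) (τ : ℍ) : ℂ :=
  ∑ s ∈ Finset.range (n - m + 1),
    ((m + s).choose s : ℂ) *
      ((ascPochhammer ℂ s).eval (k + m) / (ascPochhammer ℂ s).eval (K - 2 * m - s - 1)) *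
      (normalizedDerivOfComplex^[s] (L.coeff (m + s))) τ

end MLDO

end

/-! Put x = (2πi)⁻¹ c/(cτ+d), so that Dx = -x². Testing equivariance on e^{2πicτ} for all c ∈ ℂ and
comparing powers of c shows that a_j|γ is the value at x of a polynomial P_j with coefficients built
from the a_r and with P_j(0) = a_j (`transPoly`, `slash_coeff_apply`).

Modularity of h_m: slashing turns D into the covariant derivative ∇ = D + w·x, so h_m|γ is the value
at X = x of the same combination formed from ∇^s P_{m+s}. As P_r' is a multiple of P_{r+1} and d/dX
commutes with ∇ up to a scalar and a weight shift, the coefficients of h_m make the X-derivative of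
this combination vanish. It is constant in X, and its value at 0 is h_m
(`sum_hCoeff_smul_nablaIter`).

Expansion of L: the normalized brackets invert the passage from (a_r) to (h_m), by a telescoping
factorial sum (`sum_bracketCoeff_mul_hCoeff`); this needs no modularity. The bracket of order n-1 is
left over. It contains a_{n-1}, a multiple of `E2` because level one has no nonzero forms of weight
2, and together with D^n it gives the Kaneko–Koike operator. -/

namespace MLDO

/-! ### Covariant derivatives over a differential ring. -/

section DifferentialAlgebra

open Polynomial Differential

variable {R : Type*} [CommRing R] [Differential R] [Algebra ℂ R]

/-- The covariant derivative `P ↦ DP + w X P` on `R[X]`, where `X` is a formal solution of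
`DX = -X²`. -/
noncomputable def polyNabla (w : ℂ) (P : R[X]) : R[X] :=
  implicitDeriv (-X ^ 2) P + w • (X * P)

/-- The iterated covariant derivative of `P` of weight `v`, which raises the weight by `2 s`. -/
noncomputable def polyNablaIter (v : ℂ) : ℕ → R[X] → R[X]
  | 0, P => P
  | s + 1, P => polyNabla (v + 2 * s) (polyNablaIter v s P)

omit [Algebra ℂ R] in
lemma derivative_mapCoeffs (P : R[X]) :
    derivative (mapCoeffs P) = mapCoeffs (derivative P) := by
  ext i
  simp only [coeff_derivative, coeff_mapCoeffs]
  have h : ((i : R) + 1)′ = 0 := by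
    rw [map_add, Derivation.map_natCast, Derivation.map_one_eq_zero, add_zero]
  rw [Derivation.leibniz, h]
  simp [mul_comm]

/-- An 𝔰𝔩₂-type relation: differentiating -X² contributes -2X·P', which lowers the weight by 2, and
differentiating wX contributes the scalar w. -/
lemma derivative_polyNabla (w : ℂ) (P : R[X]) :
    derivative (polyNabla w P) = polyNabla (w - 2) (derivative P) + w • P := by
  simp only [polyNabla, implicitDeriv, Derivation.add_apply, Derivation.smul_apply,
    Derivation.restrictScalars_apply, smul_eq_mul, derivative_add,
    derivative_mul, derivative_mapCoeffs, derivative_neg, derivative_X_pow, derivative_X,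
    Algebra.smul_def, Polynomial.algebraMap_apply, map_sub, derivative_C]
  simp only [Polynomial.derivative'_apply, map_ofNat]
  simp
  rw [show (C 2 : R[X]) = 2 from map_ofNat C 2]
  ring

lemma polyNabla_add (w : ℂ) (P Q : R[X]) :
    polyNabla w (P + Q) = polyNabla w P + polyNabla w Q := by
  simp only [polyNabla, map_add, mul_add, smul_add]; abel

lemma polyNabla_smul (hD : ∀ c : ℂ, (algebraMap ℂ R c)′ = 0) (w c : ℂ) (P : R[X]) :
    polyNabla w (c • P) = c • polyNabla w P := by
  simp only [polyNabla, Algebra.smul_def, Polynomial.algebraMap_apply, Derivation.leibniz,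
    implicitDeriv_C, hD, map_zero, Algebra.algebraMap_self, RingHom.id_apply]
  ring

lemma polyNablaIter_smul (hD : ∀ c : ℂ, (algebraMap ℂ R c)′ = 0) (v c : ℂ) (s : ℕ) (P : R[X]) :
    polyNablaIter v s (c • P) = c • polyNablaIter v s P := by
  induction s with
  | zero => rfl
  | succ s ih => simp only [polyNablaIter, ih, polyNabla_smul hD]

/-- Each of the s factors contributes its weight, and v + (v+2) + ⋯ + (v+2s-2) = s(v+s-1). The
factors to the left of the removed one drop by 2 in weight and so close the gap. At s = 0 the
truncated `s - 1` is harmless, its coefficient being 0. -/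
lemma derivative_polyNablaIter (hD : ∀ c : ℂ, (algebraMap ℂ R c)′ = 0) (v : ℂ) (s : ℕ)
    (P : R[X]) :
    derivative (polyNablaIter v s P) = polyNablaIter (v - 2) s (derivative P) +
      (s * (v + s - 1)) • polyNablaIter v (s - 1) P := by
  induction s with
  | zero => simp [polyNablaIter]
  | succ s ih =>
    rw [polyNablaIter, derivative_polyNabla, ih, polyNabla_add, polyNabla_smul hD, polyNablaIter,
      show v + 2 * s - 2 = v - 2 + 2 * (s : ℂ) by ring, add_assoc, add_tsub_cancel_right]
    congr 1
    cases s with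
    | zero => simp [polyNablaIter]
    | succ s =>
      rw [show v - 2 + 2 * ((s + 1 : ℕ) : ℂ) = v + 2 * s by push_cast; ring, add_tsub_cancel_right,
        ← polyNablaIter, ← add_smul]
      congr 1
      push_cast
      ring

/-- The covariant derivative for a solution `x` of `Dx = -x²`. -/
noncomputable def nabla (x : R) (w : ℂ) (f : R) : R := f′ + w • (x * f)

/-- The iterated covariant derivative of `f` of weight `v`. -/
noncomputable def nablaIter (x : R) (v : ℂ) : ℕ → R → R
  | 0, f => f
  | s + 1, f => nabla x (v + 2 * s) (nablaIter x v s f)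

lemma eval_polyNabla {x : R} (hx : x′ = -x ^ 2) (w : ℂ) (P : R[X]) :
    eval x (polyNabla w P) = nabla x w (eval x P) := by
  have h := deriv_aeval_eq_implicitDeriv (A := R) (R := R) x (-X ^ 2) (by simpa using hx) P
  simp only [coe_aeval_eq_eval] at h
  simp [polyNabla, nabla, h]

lemma eval_polyNablaIter {x : R} (hx : x′ = -x ^ 2) (v : ℂ) (s : ℕ) (P : R[X]) :
    eval x (polyNablaIter v s P) = nablaIter x v s (eval x P) := by
  induction s with
  | zero => rfl
  | succ s ih => rw [polyNablaIter, nablaIter, eval_polyNabla hx, ih]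

lemma nablaIter_zero (v : ℂ) (s : ℕ) (f : R) :
    nablaIter 0 v s f = (fun g : R => g′)^[s] f := by
  induction s with
  | zero => rfl
  | succ s ih => rw [nablaIter, Function.iterate_succ_apply', ih]; simp [nabla]

/-- The polynomial `∑_p C(r+p, p) (k+r)_p (-X)^p a_{r+p}`, which describes the transformation
of the coefficient `a_r` of a modular differential operator. -/
noncomputable def transPoly (k : ℂ) (n : ℕ) (a : ℕ → R) (r : ℕ) : R[X] :=
  ∑ p ∈ Finset.range (n + 1),
    monomial p ((((r + p).choose p : ℂ) * (ascPochhammer ℂ p).eval (k + r) * (-1) ^ p) • a (r + p))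

lemma ascPochhammer_eval_succ_left (s : ℕ) (x : ℂ) :
    (ascPochhammer ℂ (s + 1)).eval x = x * (ascPochhammer ℂ s).eval (x + 1) := by
  rw [ascPochhammer_succ_left]; simp

omit [Differential R] in
lemma derivative_transPoly (k : ℂ) {n : ℕ} {a : ℕ → R} (ha : ∀ r, n < r → a r = 0) (r : ℕ) :
    derivative (transPoly k n a r) = (-((r + 1) * (k + r)) : ℂ) • transPoly k n a (r + 1) := by
  -- Differentiation leaves only degrees below n; the degree n term on the right vanishes with `a (r
  -- + 1 + n)`.
  rw [transPoly, Finset.sum_range_succ', transPoly, Finset.sum_range_succ, ha (r + 1 + n) (by omega)]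
  simp only [derivative_add, derivative_sum, derivative_monomial, Finset.smul_sum,
    smul_zero, map_zero, add_zero, Nat.cast_zero, mul_zero]
  refine Finset.sum_congr rfl fun p _ => ?_
  rw [add_tsub_cancel_right, smul_monomial, smul_smul, show r + (p + 1) = r + 1 + p by ring]
  congr 1
  have h : ((r + 1 + p).choose (p + 1) : ℂ) * (p + 1) = (r + 1) * ((r + 1 + p).choose p) := by
    have h1 := Nat.choose_succ_right_eq (r + 1 + p) p
    rw [show r + 1 + p - p = r + 1 by omega] at h1
    have h2 : (((r + 1 + p).choose (p + 1) * (p + 1) : ℕ) : ℂ) =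
      (((r + 1 + p).choose p * (r + 1) : ℕ) : ℂ) := by rw [h1]
    push_cast at h2
    rw [h2]; ring
  rw [mul_comm, ← nsmul_eq_mul, ← Nat.cast_smul_eq_nsmul ℂ, smul_smul,
    ascPochhammer_eval_succ_left]
  congr 1
  push_cast
  rw [show k + (r + 1) = k + r + (1 : ℂ) by ring]
  linear_combination (k + r) * (ascPochhammer ℂ p).eval (k + r + 1) * (-1) ^ (p + 1) * h

omit [Differential R] in
lemma eval_transPoly (k : ℂ) (n : ℕ) (a : ℕ → R) (r : ℕ) (x : R) :
    eval x (transPoly k n a r) = ∑ p ∈ Finset.range (n + 1),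
      (((r + p).choose p : ℂ) * (ascPochhammer ℂ p).eval (k + r)) • ((-x) ^ p * a (r + p)) := by
  rw [transPoly, eval_finsetSum]
  refine Finset.sum_congr rfl fun p _ => ?_
  rw [eval_monomial, neg_pow x]
  simp only [Algebra.smul_def, map_mul, map_pow, map_neg, map_one]
  ring

omit [Differential R] in
lemma eval_zero_transPoly (k : ℂ) (n : ℕ) (a : ℕ → R) (r : ℕ) :
    eval 0 (transPoly k n a r) = a r := by
  rw [eval_transPoly, Finset.sum_eq_single_of_mem 0 (by simp)]
  · simp
  · intro p _ hp
    simp [hp]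

/-- The coefficient of `D^s a_{m+s}` in the modular form `h_m` of weight `W`. -/
noncomputable def hCoeff (k W : ℂ) (m s : ℕ) : ℂ :=
  ((m + s).choose s : ℂ) *
    ((ascPochhammer ℂ s).eval (k + m) / (ascPochhammer ℂ s).eval (W - s - 1))

lemma hCoeff_succ (k W : ℂ) (m s : ℕ) (h : W - s - 2 ≠ 0) :
    hCoeff k W m (s + 1) * ((s + 1) * (W - s - 2)) =
      hCoeff k W m s * ((m + s + 1) * (k + m + s)) := by
  have hc : ((m + s + 1).choose (s + 1) : ℂ) * (s + 1) = (m + s + 1) * ((m + s).choose s) := by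
    exact_mod_cast (Nat.add_one_mul_choose_eq (m + s) s).symm
  have e1 : W - ((s + 1 : ℕ) : ℂ) - 1 = W - s - 2 := by push_cast; ring
  have e2 : W - s - 2 + 1 = W - s - 1 := by ring
  rw [hCoeff, hCoeff, ← add_assoc, e1, ascPochhammer_eval_succ_left s (W - s - 2), e2,
    ascPochhammer_succ_eval]
  -- A vanishing common denominator makes both quotients 0, by the convention x/0 = 0.
  by_cases h0 : (ascPochhammer ℂ s).eval (W - s - 1) = 0
  · simp [h0]
  field_simp
  linear_combination (ascPochhammer ℂ s).eval (k + m) * (k + m + s) * hc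

/-- Summand s yields ∇^s of P_{m+s+1} from differentiating P, and summand s+1 yields the same
polynomial, with the same weight W-2s-2, from the commutator. `hCoeff_succ` says exactly that the
two cancel. -/
lemma derivative_sum_hCoeff_smul (hD : ∀ c : ℂ, (algebraMap ℂ R c)′ = 0) (k W : ℂ)
    (m M : ℕ) {a : ℕ → R} (ha : ∀ r, m + M < r → a r = 0)
    (hW : ∀ s, s < M → W - s - 2 ≠ 0) :
    derivative (∑ s ∈ Finset.range (M + 1),
      hCoeff k W m s • polyNablaIter (W - 2 * s) s (transPoly k (m + M) a (m + s))) = 0 := by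
  simp only [derivative_sum, derivative_smul, derivative_polyNablaIter hD,
    derivative_transPoly k ha, polyNablaIter_smul hD, smul_add, Finset.sum_add_distrib]
  rw [Finset.sum_range_succ, Finset.sum_range_succ' (fun s => hCoeff k W m s •
    ((s : ℂ) * (W - 2 * s + s - 1)) • polyNablaIter (W - 2 * s) (s - 1)
      (transPoly k (m + M) a (m + s)))]
  have h0 : transPoly k (m + M) a (m + M + 1) = 0 := by
    refine Finset.sum_eq_zero fun p _ => ?_
    rw [ha _ (by omega), smul_zero, map_zero]
  have h1 : ∀ (v : ℂ) (s : ℕ), polyNablaIter v s (0 : R[X]) = 0 := by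
    intro v s
    simpa using polyNablaIter_smul hD v 0 s (0 : R[X])
  rw [h0, h1]
  simp only [smul_zero, add_zero, CharP.cast_eq_zero, zero_mul, zero_smul]
  rw [← Finset.sum_add_distrib]
  refine Finset.sum_eq_zero fun s hs => ?_
  have h2 := hCoeff_succ k W m s (hW s (Finset.mem_range.1 hs))
  rw [add_tsub_cancel_right, smul_smul, smul_smul, ← add_assoc,
    show W - 2 * ((s + 1 : ℕ) : ℂ) = W - 2 * s - 2 by push_cast; ring, ← add_smul]
  have h3 : hCoeff k W m s * -(((m + s : ℕ) + 1) * (k + (m + s : ℕ))) + hCoeff k W m (s + 1) *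
      (((s + 1 : ℕ) : ℂ) * (W - 2 * s - 2 + ((s + 1 : ℕ) : ℂ) - 1)) = 0 := by
    push_cast
    linear_combination h2
  rw [h3, zero_smul]

theorem sum_hCoeff_smul_nablaIter (hD : ∀ c : ℂ, (algebraMap ℂ R c)′ = 0) {x : R}
    (hx : x′ = -x ^ 2) (k W : ℂ) (m M : ℕ) {a : ℕ → R} (ha : ∀ r, m + M < r → a r = 0)
    (hW : ∀ s, s < M → W - s - 2 ≠ 0) :
    ∑ s ∈ Finset.range (M + 1), hCoeff k W m s •
        nablaIter x (W - 2 * s) s (eval x (transPoly k (m + M) a (m + s))) =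
      ∑ s ∈ Finset.range (M + 1), hCoeff k W m s • (fun g : R => g′)^[s] (a (m + s)) := by
  -- Zero derivative forces a constant polynomial only in the absence of torsion, here supplied by
  -- ℂ.
  have : IsAddTorsionFree R := by
    let : Module ℚ R := Module.compHom R (algebraMap ℚ ℂ)
    exact IsAddTorsionFree.of_module_rat R
  have h := eq_C_of_derivative_eq_zero (derivative_sum_hCoeff_smul hD k W m M ha hW)
  have h1 := congrArg (eval x) h
  have h2 := congrArg (eval (0 : R)) h
  rw [eval_C] at h1 h2
  rw [← h2] at h1
  -- The point 0 solves the same equation, and there ∇ is the plain derivative.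
  have h0 : (0 : R)′ = -0 ^ 2 := by simp
  simpa only [eval_finsetSum, eval_smul, eval_polyNablaIter hx, eval_polyNablaIter h0,
    eval_zero_transPoly, nablaIter_zero] using h1

lemma choose_mul_ascPochhammer_succ (k : ℂ) (r j : ℕ) (hj : j ≤ r) :
    ((r + 1).choose (j + 1) : ℂ) * (ascPochhammer ℂ (r - j)).eval (k + (j + 1 : ℕ)) =
      (r.choose j : ℂ) * (ascPochhammer ℂ (r - j)).eval (k + j) +
      (r.choose (j + 1) : ℂ) * ((ascPochhammer ℂ (r - (j + 1))).eval (k + (j + 1 : ℕ)) *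
        (r + k + (j + 1 : ℕ))) := by
  obtain ⟨q, rfl⟩ := Nat.exists_eq_add_of_le hj
  cases q with
  | zero => simp
  | succ q =>
    have h : ((j + (q + 1)).choose (j + 1) : ℂ) * (j + 1) =
        ((j + (q + 1)).choose j : ℂ) * (q + 1) := by
      have h1 := Nat.choose_succ_right_eq (j + (q + 1)) j
      rw [add_tsub_cancel_left] at h1
      exact_mod_cast h1
    rw [add_tsub_cancel_left, show j + (q + 1) - (j + 1) = q by omega, ascPochhammer_succ_eval,
      ascPochhammer_eval_succ_left, Nat.choose_succ_succ]
    push_cast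
    rw [show k + ((j : ℂ) + 1) = k + j + 1 by ring]
    linear_combination -(ascPochhammer ℂ q).eval (k + j + 1) * h

/-- Meant for F j = (D^j f)|_{k+2j} γ, for which `hF` is the product rule; the induction step is the
Pascal-type identity `choose_mul_ascPochhammer_succ`. -/
lemma iterate_deriv_eq_sum (hD : ∀ c : ℂ, (algebraMap ℂ R c)′ = 0) {x : R}
    (hx : x′ = -x ^ 2) (k : ℂ) (F : ℕ → R) (hF : ∀ j, (F j)′ = F (j + 1) - (k + 2 * j) • (x * F j))
    (r : ℕ) :
    (fun g : R => g′)^[r] (F 0) = ∑ j ∈ Finset.range (r + 1),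
      ((r.choose j : ℂ) * (ascPochhammer ℂ (r - j)).eval (k + j)) • ((-x) ^ (r - j) * F j) := by
  have hs : ∀ (c : ℂ) (g : R), (c • g)′ = c • g′ := fun c g => by
    rw [Algebra.smul_def, Derivation.leibniz, hD, smul_zero, add_zero, smul_eq_mul,
      ← Algebra.smul_def]
  have hp : ∀ (p j : ℕ), ((-x) ^ p * F j)′ =
      (-x) ^ p * F (j + 1) + (p + k + 2 * j) • ((-x) ^ (p + 1) * F j) := by
    intro p j
    rw [Derivation.leibniz, Derivation.leibniz_pow, map_neg, hx, hF]
    cases p with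
    | zero => simp [Algebra.smul_def]; ring
    | succ p =>
      simp only [smul_eq_mul, nsmul_eq_mul]
      simp only [Algebra.smul_def, map_add, map_mul, map_natCast, map_ofNat,
        add_tsub_cancel_right]
      push_cast
      ring
  induction r with
  | zero => simp
  | succ r ih =>
    rw [Function.iterate_succ_apply', ih, map_sum]
    simp only [hs, hp, smul_add, Finset.sum_add_distrib, smul_smul]
    rw [Finset.sum_range_succ' (n := r + 1), Finset.sum_range_succ' (n := r)
      (f := fun j => ((r.choose j : ℂ) * (ascPochhammer ℂ (r - j)).eval (k + j) *
        ((r - j : ℕ) + k + 2 * j)) • ((-x) ^ (r - j + 1) * F j))]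
    have hlast : ∑ j ∈ Finset.range (r + 1), ((r.choose (j + 1) : ℂ) *
        (ascPochhammer ℂ (r - (j + 1))).eval (k + (j + 1 : ℕ)) *
        (r + k + (j + 1 : ℕ))) • ((-x) ^ (r - j) * F (j + 1)) =
        ∑ j ∈ Finset.range r, ((r.choose (j + 1) : ℂ) *
        (ascPochhammer ℂ (r - (j + 1))).eval (k + (j + 1 : ℕ)) *
        ((r - (j + 1) : ℕ) + k + 2 * (j + 1 : ℕ))) • ((-x) ^ (r - (j + 1) + 1) * F (j + 1)) := by
      rw [Finset.sum_range_succ, Nat.choose_eq_zero_of_lt (Nat.lt_succ_self r)]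
      simp only [Nat.cast_zero, zero_mul, zero_smul, add_zero]
      refine Finset.sum_congr rfl fun j hj => ?_
      have hj := Finset.mem_range.1 hj
      rw [show r - (j + 1) + 1 = r - j by omega, Nat.cast_sub (by omega : j + 1 ≤ r)]
      congr 2
      push_cast
      ring
    rw [← hlast, ← add_assoc, ← Finset.sum_add_distrib]
    congr 1
    · refine Finset.sum_congr rfl fun j hj => ?_
      have hj := Finset.mem_range.1 hj
      rw [← add_smul, show r + 1 - (j + 1) = r - j by omega,
        choose_mul_ascPochhammer_succ k r j (by omega), mul_assoc]
    · simp only [tsub_zero, Nat.choose_zero_right, Nat.cast_zero, Nat.cast_one, one_mul, add_zero,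
        mul_zero, ascPochhammer_succ_eval]
      rw [add_comm k]

end DifferentialAlgebra

end MLDO

/-! ### Holomorphic functions on ℍ and the slash operator. -/

noncomputable section

namespace MLDO

open Complex UpperHalfPlane

open Differential

/-- The ring of holomorphic functions on the upper half-plane. -/
def Holo : Subalgebra ℂ (ℍ → ℂ) where
  carrier := {f | MDiff f}
  mul_mem' hf hg := MDifferentiable.mul hf hg
  add_mem' hf hg := MDifferentiable.add hf hg
  algebraMap_mem' _ := mdifferentiable_const

instance : Differential Holo where
  deriv := Derivation.mk' (AddMonoidHom.toIntLinearMap (AddMonoidHom.mk'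
      (fun f : Holo => (⟨normalizedDerivOfComplex f,
        normalizedDerivOfComplex_mdifferentiable f.2⟩ : Holo))
      (fun f g => Subtype.ext (normalizedDerivOfComplex_add _ _ f.2 g.2))))
    (fun f g => Subtype.ext (by
      have h := normalizedDerivOfComplex_mul _ _ f.2 g.2
      simp only [AddMonoidHom.coe_toIntLinearMap, AddMonoidHom.mk'_apply, smul_eq_mul]
      refine h.trans ?_
      ext τ
      simp
      ring))

lemma Holo.coe_deriv (f : Holo) : ((f′ : Holo) : ℍ → ℂ) = normalizedDerivOfComplex f := rfl

lemma Holo.coe_iterate_deriv (f : Holo) (s : ℕ) :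
    (((fun g : Holo => g′)^[s] f : Holo) : ℍ → ℂ) = normalizedDerivOfComplex^[s] f := by
  induction s with
  | zero => rfl
  | succ s ih => rw [Function.iterate_succ_apply', Function.iterate_succ_apply', ← ih]; rfl

lemma Holo.deriv_algebraMap (c : ℂ) : (algebraMap ℂ Holo c)′ = 0 :=
  Subtype.ext (normalizedDerivOfComplex_const c)

lemma mdifferentiable_iterate_normalizedDeriv {f : ℍ → ℂ} (hf : MDiff f) (s : ℕ) :
    MDiff (normalizedDerivOfComplex^[s] f) := by
  rw [← Holo.coe_iterate_deriv ⟨f, hf⟩]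
  exact Subtype.property _

lemma hasDerivAt_denom_cpow (γ : SL(2, ℤ)) (τ : ℍ) (k : ℂ) :
    HasDerivAt (fun z : ℂ => denom γ z ^ k) (k * γ 1 0 * denom γ τ ^ (k - 1)) τ := by
  have hd : HasDerivAt (fun z : ℂ => denom γ z) (γ 1 0 : ℂ) τ := by
    simpa [denom] using ((hasDerivAt_id (τ : ℂ)).const_mul ((γ 1 0 : ℤ) : ℂ)).add_const
      ((γ 1 1 : ℤ) : ℂ)
  -- If c = 0 the base is a constant that may lie on the branch cut, but then the power is constant;
  -- if c ≠ 0 the base is not real.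
  by_cases hc : γ 1 0 = 0
  · have h : (fun z : ℂ => denom γ z ^ k) = fun _ => ((γ 1 1 : ℤ) : ℂ) ^ k := by
      ext z; simp [denom, hc]
    rw [h, hc]
    simpa using hasDerivAt_const (τ : ℂ) (((γ 1 1 : ℤ) : ℂ) ^ k)
  · have h := hd.cpow_const (c := k) (Or.inr ?_)
    · convert! h using 1; ring
    · have : (denom γ (τ : ℂ)).im = γ 1 0 * τ.im := by simp [denom]
      rw [this]
      exact mul_ne_zero (by exact_mod_cast hc) τ.im_ne_zero

/-- The logarithmic derivative `(2πi)⁻¹ c / (cτ + d)` of the automorphy factor. -/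
def logFactor (γ : SL(2, ℤ)) (τ : ℍ) : ℂ := (2 * Real.pi * Complex.I)⁻¹ * (γ 1 0 / denom γ τ)

lemma hasDerivAt_slash (k : ℂ) (γ : SL(2, ℤ)) {f : ℍ → ℂ} (hf : MDiff f) (τ : ℍ) :
    HasDerivAt (slash k γ f ∘ ofComplex) (denom γ τ ^ (-(k + 2)) *
      deriv (f ∘ ofComplex) ↑(γ • τ) - k * (γ 1 0 / denom γ τ) * slash k γ f τ) τ := by
  have hdet0 : (γ : GL (Fin 2) ℝ).val.det = 1 := by
    rw [← Matrix.GeneralLinearGroup.val_det_apply]; simp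
  have hdet : 0 < (γ : GL (Fin 2) ℝ).val.det := by rw [hdet0]; exact one_pos
  have hdet1 : ((γ : GL (Fin 2) ℝ).val.det : ℂ) = 1 := by rw [hdet0]; exact ofReal_one
  have hz := denom_ne_zero γ τ
  have h1 : HasDerivAt (fun w : ℂ ↦ ((γ • ofComplex w : ℍ) : ℂ)) (1 / denom γ τ ^ 2) τ := by
    have := (hasStrictDerivAt_smul hdet τ).hasDerivAt
    rwa [hdet1] at this
  have h2 : HasDerivAt (f ∘ ofComplex) (deriv (f ∘ ofComplex) ↑(γ • τ))
      ((γ • ofComplex (τ : ℂ) : ℍ) : ℂ) := by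
    rw [ofComplex_apply]
    exact (mdifferentiableAt_iff.mp (hf (γ • τ))).hasDerivAt
  have h3 := (hasDerivAt_denom_cpow γ τ (-k)).mul (h2.comp (τ : ℂ) h1)
  have h4 : slash k γ f ∘ ofComplex =ᶠ[nhds (τ : ℂ)] fun z => denom γ z ^ (-k) *
      ((f ∘ ofComplex) ∘ fun w : ℂ ↦ ((γ • ofComplex w : ℍ) : ℂ)) z := by
    filter_upwards [isOpen_upperHalfPlaneSet.mem_nhds τ.im_pos] with w hw
    simp only [Function.comp_apply, slash, ofComplex_apply]
    rw [ofComplex_apply_of_im_pos hw]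
  refine (h3.congr_of_eventuallyEq h4).congr_deriv ?_
  simp only [Function.comp_apply, ofComplex_apply, slash]
  have e1 : ∀ {d : ℂ}, d ≠ 0 → d ^ (-k - 1) = d ^ (-k) / d := fun h => by
    rw [cpow_sub _ _ h, cpow_one]
  have e2 : ∀ {d : ℂ}, d ≠ 0 → d ^ (-(k + 2)) = d ^ (-k) / d ^ 2 := fun h => by
    rw [show -(k + 2) = -k - (2 : ℕ) by push_cast; ring, cpow_sub _ _ h, cpow_natCast]
  rw [e1 hz, e2 hz]
  field_simp
  ring

lemma mdifferentiable_slash (k : ℂ) (γ : SL(2, ℤ)) {f : ℍ → ℂ} (hf : MDiff f) :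
    MDiff (slash k γ f) := fun τ =>
  mdifferentiableAt_iff.mpr (hasDerivAt_slash k γ hf τ).differentiableAt

lemma normalizedDeriv_slash (k : ℂ) (γ : SL(2, ℤ)) {f : ℍ → ℂ} (hf : MDiff f) (τ : ℍ) :
    normalizedDerivOfComplex (slash k γ f) τ =
      slash (k + 2) γ (normalizedDerivOfComplex f) τ - k * (logFactor γ τ * slash k γ f τ) := by
  rw [normalizedDerivOfComplex, (hasDerivAt_slash k γ hf τ).deriv]
  simp only [slash, logFactor, normalizedDerivOfComplex]
  ring

/-- Being a multiple of the slashed constant 1 in weight 1, the factor inherits holomorphy and its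
Riccati equation from the rules for `slash`. -/
lemma logFactor_eq (γ : SL(2, ℤ)) :
    logFactor γ = ((2 * Real.pi * Complex.I)⁻¹ * γ 1 0 : ℂ) • slash 1 γ 1 := by
  ext τ
  simp only [logFactor, Pi.smul_apply, slash, cpow_neg_one, smul_eq_mul, Pi.one_apply]
  ring

/-- The slash operator on the ring of holomorphic functions. -/
def Holo.slash (k : ℂ) (γ : SL(2, ℤ)) (f : Holo) : Holo :=
  ⟨MLDO.slash k γ f, mdifferentiable_slash k γ f.2⟩

/-- `logFactor` as a holomorphic function. -/
def Holo.logFactor (γ : SL(2, ℤ)) : Holo :=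
  ⟨MLDO.logFactor γ, by
    rw [logFactor_eq]
    exact Holo.smul_mem (mdifferentiable_slash 1 γ (Holo.one_mem)) _⟩

lemma Holo.deriv_slash (k : ℂ) (γ : SL(2, ℤ)) (f : Holo) :
    (Holo.slash k γ f)′ =
      Holo.slash (k + 2) γ f′ - k • (Holo.logFactor γ * Holo.slash k γ f) :=
  Subtype.ext (funext (normalizedDeriv_slash k γ f.2))

lemma Holo.deriv_logFactor (γ : SL(2, ℤ)) :
    (Holo.logFactor γ)′ = -Holo.logFactor γ ^ 2 := by
  refine Subtype.ext ?_
  rw [Holo.coe_deriv]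
  change normalizedDerivOfComplex (MLDO.logFactor γ) = -MLDO.logFactor γ ^ 2
  have h1 : MDiff (1 : ℍ → ℂ) := Holo.one_mem
  rw [logFactor_eq, normalizedDerivOfComplex_smul _ _ (mdifferentiable_slash 1 γ h1),
    ← logFactor_eq]
  ext τ
  simp only [Pi.smul_apply, normalizedDeriv_slash 1 γ h1, Pi.neg_apply, Pi.pow_apply]
  have h0 : normalizedDerivOfComplex (1 : ℍ → ℂ) = 0 := normalizedDerivOfComplex_const 1
  have h2 : MLDO.logFactor γ τ = ((2 * Real.pi * Complex.I)⁻¹ * γ 1 0 : ℂ) * MLDO.slash 1 γ 1 τ := by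
    rw [logFactor_eq]; rfl
  rw [h0]
  simp only [MLDO.slash, Pi.zero_apply, mul_zero, zero_sub, smul_eq_mul, one_mul] at h2 ⊢
  linear_combination (-MLDO.logFactor γ τ) * h2.symm

lemma Holo.slash_iterate_deriv (v : ℂ) (γ : SL(2, ℤ)) (f : Holo) (s : ℕ) :
    Holo.slash (v + 2 * s) γ ((fun g : Holo => g′)^[s] f) =
      nablaIter (Holo.logFactor γ) v s (Holo.slash v γ f) := by
  induction s with
  | zero => simp [nablaIter]
  | succ s ih =>
    rw [nablaIter, ← ih, nabla, Holo.deriv_slash, Function.iterate_succ_apply', sub_add_cancel]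
    congr 1
    push_cast
    ring

lemma Holo.iterate_deriv_slash (k : ℂ) (γ : SL(2, ℤ)) (f : Holo) (r : ℕ) :
    (fun g : Holo => g′)^[r] (Holo.slash k γ f) = ∑ j ∈ Finset.range (r + 1),
      ((r.choose j : ℂ) * (ascPochhammer ℂ (r - j)).eval (k + j)) •
        ((-Holo.logFactor γ) ^ (r - j) *
          Holo.slash (k + 2 * j) γ ((fun g : Holo => g′)^[j] f)) := by
  have h := iterate_deriv_eq_sum Holo.deriv_algebraMap (Holo.deriv_logFactor γ) k
    (fun j => Holo.slash (k + 2 * j) γ ((fun g : Holo => g′)^[j] f)) (fun j => ?_) r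
  · simpa using h
  · rw [Holo.deriv_slash, Function.iterate_succ_apply']
    congr 2
    push_cast
    ring

/-! ### Boundedness at the cusp and level one modular forms. -/

/-- Derivatives of functions bounded at `i∞` are bounded at `i∞`. -/
lemma isBoundedAtImInfty_normalizedDeriv {f : ℍ → ℂ} (hf : MDiff f)
    (hb : IsBoundedAtImInfty f) : IsBoundedAtImInfty (normalizedDerivOfComplex f) := by
  rw [isBoundedAtImInfty_iff] at hb ⊢
  obtain ⟨M, A, h⟩ := hb
  -- Cauchy's estimate on unit discs; this height keeps the closed disc inside ℍ and above A.
  refine ⟨‖(2 * Real.pi * Complex.I : ℂ)⁻¹‖ * (M / 1), max A 0 + 2, fun z hz => ?_⟩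
  have him : ∀ w ∈ Metric.closedBall (z : ℂ) 1, max A 0 < w.im := by
    intro w hw
    have h1 : |(w - z).im| ≤ 1 := (abs_im_le_norm _).trans (by simpa [Complex.dist_eq] using hw)
    rw [sub_im, abs_le] at h1
    have : (z : ℂ).im = z.im := rfl
    linarith
  rw [normalizedDerivOfComplex, norm_mul]
  refine mul_le_mul_of_nonneg_left ?_ (norm_nonneg _)
  rw [UpperHalfPlane.mdifferentiable_iff] at hf
  have hsub : Metric.closedBall (z : ℂ) 1 ⊆ {w | 0 < w.im} := fun w hw =>
    (le_max_right A 0).trans_lt (him w hw)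
  refine norm_deriv_le_of_forall_mem_sphere_norm_le one_pos ?_ fun w hw => ?_
  · refine (hf.mono ?_).diffContOnCl
    rwa [closure_ball _ one_ne_zero]
  · have hw := Metric.sphere_subset_closedBall hw
    rw [Function.comp_apply, ofComplex_apply_of_im_pos (hsub hw)]
    exact h _ ((le_max_left A 0).trans (him w hw).le)

lemma isBoundedAtImInfty_iterate_normalizedDeriv {f : ℍ → ℂ} (hf : MDiff f)
    (hb : IsBoundedAtImInfty f) (s : ℕ) :
    IsBoundedAtImInfty (normalizedDerivOfComplex^[s] f) := by
  induction s with
  | zero => exact hb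
  | succ s ih =>
    rw [Function.iterate_succ_apply']
    exact isBoundedAtImInfty_normalizedDeriv (mdifferentiable_iterate_normalizedDeriv hf s) ih

lemma slash_intCast (w : ℤ) (γ : SL(2, ℤ)) (f : ℍ → ℂ) : f ∣[w] γ = slash w γ f := by
  ext τ
  rw [SL_slash_apply, slash, ← Int.cast_neg, cpow_intCast, mul_comm]

lemma exists_modularForm {w : ℤ} {f : ℍ → ℂ} (hf : MDiff f) (hb : IsBoundedAtImInfty f)
    (hs : ∀ γ : SL(2, ℤ), slash w γ f = f) : ∃ g : ModularForm 𝒮ℒ w, ∀ τ, g τ = f τ :=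
  ⟨{ toFun := f
     slash_action_eq' := fun _ ⟨γ, hγ⟩ => hγ ▸ (slash_intCast w γ f).trans (hs γ)
     holo' := hf
     bdd_at_cusps' := fun {c} hc => by
       rw [Subgroup.IsArithmetic.isCusp_iff_isCusp_SL2Z] at hc
       rw [OnePoint.isBoundedAt_iff_forall_SL2Z hc]
       intro γ _
       rwa [slash_intCast, hs γ] }, fun _ => rfl⟩

lemma eq_zero_of_weight_two {f : ℍ → ℂ} (hf : MDiff f) (hb : IsBoundedAtImInfty f)
    (hs : ∀ γ : SL(2, ℤ), slash 2 γ f = f) : f = 0 := by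
  obtain ⟨g, hg⟩ := exists_modularForm (w := 2) hf hb (by simpa using hs)
  have h := rank_zero_iff_forall_zero.mp ModularForm.levelOne_weight_two_rank_zero g
  ext τ
  rw [← hg, h]
  rfl

lemma slash_E2 (γ : SL(2, ℤ)) : slash 2 γ E2 = E2 + (12 : ℂ) • logFactor γ := by
  have h := E2_slash_action γ
  rw [slash_intCast] at h
  rw [show (2 : ℂ) = ((2 : ℤ) : ℂ) by norm_num, h]
  ext τ
  have hpi : (Real.pi : ℂ) ≠ 0 := by exact_mod_cast Real.pi_ne_zero
  simp only [Pi.sub_apply, Pi.smul_apply, Pi.add_apply, D2, logFactor, riemannZeta_two,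
    smul_eq_mul]
  field_simp [denom_ne_zero γ τ]
  linear_combination (-12 * (γ 1 0 : ℂ)) * Complex.I_sq

end MLDO

end

/-! ### Combinatorial inversion of the brackets. -/

namespace MLDO

open Nat Finset

/-- A closed form for partial sums, so that induction on J applies; only J = u + 1 is used, where
`u.choose J` makes the full sum 0. The bound on J keeps all natural subtractions exact. -/
lemma sum_neg_one_pow_choose_mul_factorial (u d J : ℕ) (hJ : J ≤ u + 1) :
    ∑ j ∈ range (J + 1), (-1 : ℂ) ^ j * (u + 1).choose j * (2 * u + 2 * d + 3 - 2 * j) *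
      ((2 * u + 2 * d + 3 - j - u - 2)! / (2 * u + 2 * d + 3 - j)!) =
    (-1) ^ J * u.choose J * ((2 * u + 2 * d + 3 - J - u - 2)! / (2 * u + 2 * d + 3 - J - 1)!) := by
  induction J with
  | zero =>
    simp only [zero_add, range_one, sum_singleton, Nat.choose_zero_right, tsub_zero]
    rw [show 2 * u + 2 * d + 3 - 1 = 2 * u + 2 * d + 2 by omega,
      show (2 * u + 2 * d + 3)! = (2 * u + 2 * d + 3) * (2 * u + 2 * d + 2)! from
        Nat.factorial_succ _]
    have h1 : ((2 * u + 2 * d + 2)! : ℂ) ≠ 0 := Nat.cast_ne_zero.2 (Nat.factorial_ne_zero _)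
    have h2 : ((2 * u + 2 * d + 3 : ℕ) : ℂ) ≠ 0 := Nat.cast_ne_zero.2 (by omega)
    have h3 : (2 * u + 2 * d + 3 - 2 * (0 : ℕ) : ℂ) = ((2 * u + 2 * d + 3 : ℕ) : ℂ) := by
      push_cast; ring
    rw [h3, Nat.cast_mul]
    field_simp
  | succ J ih =>
    obtain ⟨e, rfl⟩ := Nat.exists_eq_add_of_le (show J ≤ u by omega)
    rw [sum_range_succ, ih (by omega)]
    rw [show 2 * (J + e) + 2 * d + 3 - J - (J + e) - 2 = (e + 2 * d) + 1 by omega,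
      show 2 * (J + e) + 2 * d + 3 - (J + 1) - (J + e) - 2 = e + 2 * d by omega,
      show 2 * (J + e) + 2 * d + 3 - J - 1 = (J + 2 * e + 2 * d + 1) + 1 by omega,
      show 2 * (J + e) + 2 * d + 3 - (J + 1) - 1 = J + 2 * e + 2 * d + 1 by omega,
      show 2 * (J + e) + 2 * d + 3 - (J + 1) = (J + 2 * e + 2 * d + 1) + 1 by omega,
      Nat.factorial_succ (e + 2 * d), Nat.factorial_succ (J + 2 * e + 2 * d + 1),
      Nat.choose_succ_succ (J + e) J]
    have hc : ((J + e).choose (J + 1) : ℂ) * (J + 1) = ((J + e).choose J : ℂ) * e := by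
      have h1 := Nat.choose_succ_right_eq (J + e) J
      rw [add_tsub_cancel_left] at h1
      exact_mod_cast h1
    have h1 : ((J + 2 * e + 2 * d + 1)! : ℂ) ≠ 0 := Nat.cast_ne_zero.2 (Nat.factorial_ne_zero _)
    have h2 : ((J + 2 * e + 2 * d + 1 + 1 : ℕ) : ℂ) ≠ 0 := Nat.cast_ne_zero.2 (by omega)
    rw [Nat.cast_mul (J + 2 * e + 2 * d + 1 + 1)]
    generalize hX : ((J + 2 * e + 2 * d + 1 + 1 : ℕ) : ℂ) = X at h2 ⊢
    field_simp
    rw [← hX]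
    push_cast
    linear_combination (-1 : ℂ) ^ J * (e + 2 * d)! * hc

lemma ringChoose_add_sub_one (a : ℂ) (j : ℕ) :
    Ring.choose (a + j - 1) j = (ascPochhammer ℂ j).eval a / (j ! : ℂ) := by
  have h := Ring.factorial_nsmul_multichoose_eq_ascPochhammer a j
  rw [Polynomial.ascPochhammer_smeval_eq_eval, Ring.multichoose_eq, nsmul_eq_mul] at h
  rw [← h]
  have h1 : (j ! : ℂ) ≠ 0 := Nat.cast_ne_zero.2 (Nat.factorial_ne_zero _)
  field_simp

lemma ascPochhammer_eval_add (a : ℂ) (j q : ℕ) :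
    (ascPochhammer ℂ (j + q)).eval a =
      (ascPochhammer ℂ j).eval a * (ascPochhammer ℂ q).eval (a + j) := by
  rw [← ascPochhammer_mul]
  simp

/-- The coefficient of `D^{m-r} h · D^r f` in the normalized bracket of `h` (of weight `2n-2m`)
and `f` (of weight `k`) of order `m`. -/
noncomputable def bracketCoeff (k : ℂ) (n m r : ℕ) : ℂ :=
  (((2 * n - m - 1).choose m : ℕ) : ℂ)⁻¹ * ((-1) ^ (m - r) *
    Ring.choose ((m : ℂ) + (2 * n - 2 * m) - 1) r * Ring.choose ((m : ℂ) + k - 1) (m - r))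

/-- Isolates a factor depending only on r and t = j + q from the summand of the telescoping sum.
Writing n = r + t + 1 + d avoids truncated subtraction. -/
lemma bracketCoeff_mul_hCoeff (k : ℂ) (r j q d : ℕ) :
    bracketCoeff k (r + (j + q) + 1 + d) (r + j) r *
        hCoeff k (2 * (r + (j + q) + 1 + d : ℕ) - 2 * (r + j : ℕ)) (r + j) q =
      ((r + (j + q))! * (ascPochhammer ℂ (j + q)).eval (k + r) / (r ! * (j + q)!)) *
      ((-1 : ℂ) ^ j * (j + q).choose j * (2 * q + 2 * d + 1) *
        ((q + 2 * d)! / (j + 2 * q + 2 * d + 1)!)) := by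
  have hf : ∀ i : ℕ, (i ! : ℂ) ≠ 0 := fun i => Nat.cast_ne_zero.2 (Nat.factorial_ne_zero _)
  have e1 : 2 * (r + (j + q) + 1 + d) - (r + j) - 1 = (r + j) + (2 * q + 2 * d + 1) := by omega
  have e2 : ((r + j : ℕ) : ℂ) + (2 * (r + (j + q) + 1 + d : ℕ) - 2 * (r + j : ℕ)) - 1 =
      ((r + (j + 2 * q + 2 * d + 1) : ℕ) : ℂ) := by push_cast; ring
  have e3 : ((r + j : ℕ) : ℂ) + k - 1 = k + r + j - 1 := by push_cast; ring
  have e4 : (2 * (r + (j + q) + 1 + d : ℕ) - 2 * (r + j : ℕ) - q - 1 : ℂ) =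
      ((q + 2 * d + 1 : ℕ) : ℂ) := by push_cast; ring
  have e5 : (ascPochhammer ℂ q).eval ((q + 2 * d + 1 : ℕ) : ℂ) =
      ((2 * q + 2 * d)! : ℂ) / (q + 2 * d)! := by
    rw [ascPochhammer_nat_eq_natCast_ascFactorial, eq_div_iff (hf _), mul_comm]
    rw [show 2 * q + 2 * d = q + 2 * d + q by ring]
    exact_mod_cast Nat.factorial_mul_ascFactorial (q + 2 * d) q
  rw [bracketCoeff, hCoeff, e1, e2, e3, e4, e5, add_tsub_cancel_left, Ring.choose_natCast,
    ringChoose_add_sub_one, ascPochhammer_eval_add, Nat.cast_add_choose ℂ, Nat.cast_add_choose ℂ,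
    Nat.cast_add_choose ℂ, add_comm (r + j) q, Nat.cast_add_choose ℂ,
    Nat.factorial_succ (2 * q + 2 * d),
    show r + j + (2 * q + 2 * d + 1) = r + (j + 2 * q + 2 * d + 1) by ring,
    show q + (r + j) = r + (j + q) by ring, show k + r + (j : ℂ) = k + (r + j : ℕ) by
      push_cast; ring]
  have h1 := hf r
  have h2 := hf j
  have h3 := hf q
  have h4 := hf (r + j)
  have h5 := hf (j + q)
  have h6 := hf (2 * q + 2 * d)
  have h7 := hf (q + 2 * d)
  have h8 := hf (j + 2 * q + 2 * d + 1)
  have h9 := hf (r + (j + 2 * q + 2 * d + 1))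
  have h10 := hf (r + (j + q))
  push_cast
  have h11 : (2 * q + 2 * d + 1 : ℂ) ≠ 0 := by
      exact_mod_cast Nat.succ_ne_zero (2 * q + 2 * d)
  field_simp

lemma sum_bracketCoeff_mul_hCoeff (k : ℂ) (n r t : ℕ) (h : r + t < n) :
    ∑ j ∈ range (t + 1), bracketCoeff k n (r + j) r *
      hCoeff k (2 * n - 2 * (r + j : ℕ)) (r + j) (t - j) = if t = 0 then 1 else 0 := by
  obtain ⟨d, rfl⟩ : ∃ d, n = r + t + 1 + d := ⟨n - (r + t + 1), by omega⟩
  rcases t with _ | u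
  · have h1 := bracketCoeff_mul_hCoeff k r 0 0 d
    have hf : ∀ i : ℕ, (i ! : ℂ) ≠ 0 := fun i => Nat.cast_ne_zero.2 (Nat.factorial_ne_zero _)
    have h3 := hf r
    have h4 := hf (2 * d)
    have h5 : (2 * d + 1 : ℂ) ≠ 0 := by
      exact_mod_cast Nat.succ_ne_zero (2 * d)
    simp only [zero_add, range_one, sum_singleton, if_true, tsub_zero, add_zero] at h1 ⊢
    rw [h1]
    simp only [ascPochhammer_zero, Polynomial.eval_one, Nat.choose_self, Nat.factorial_zero,
      mul_zero, zero_add, pow_zero, Nat.factorial_succ (2 * d)]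
    push_cast
    field_simp
    simp
  · rw [if_neg (Nat.succ_ne_zero u)]
    have h0 := sum_neg_one_pow_choose_mul_factorial u d (u + 1) le_rfl
    rw [Nat.choose_eq_zero_of_lt (Nat.lt_succ_self u)] at h0
    simp only [Nat.cast_zero, mul_zero, zero_mul] at h0
    rw [← mul_zero ((r + (u + 1))! * (ascPochhammer ℂ (u + 1)).eval (k + r) / (r ! * (u + 1)!)),
      ← h0, mul_sum]
    refine sum_congr rfl fun j hj => ?_
    obtain ⟨q, hq⟩ := Nat.exists_eq_add_of_le (show j ≤ u + 1 by have := mem_range.1 hj; omega)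
    have h1 := bracketCoeff_mul_hCoeff k r j q d
    have hu : (u : ℂ) = j + q - 1 := by
      rw [eq_sub_iff_add_eq]; exact_mod_cast hq
    rw [← hq] at h1
    rw [show u + 1 - j = q by omega, h1, show 2 * u + 2 * d + 3 - j - u - 2 = q + 2 * d by omega,
      show 2 * u + 2 * d + 3 - j = j + 2 * q + 2 * d + 1 by omega, hu]
    congr 3
    ring

lemma rankinCohen_eq (k l : ℂ) (m : ℕ) (g f : ℍ → ℂ) (τ : ℍ) :
    rankinCohen l k m g f τ = ∑ r ∈ range (m + 1), (-1) ^ (m - r) *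
      Ring.choose ((m : ℂ) + l - 1) r * Ring.choose ((m : ℂ) + k - 1) (m - r) *
      (normalizedDerivOfComplex^[m - r] g) τ * (normalizedDerivOfComplex^[r] f) τ := by
  rw [rankinCohen, ← Finset.sum_flip]
  refine sum_congr rfl fun r hr => ?_
  rw [show m - (m - r) = r by have := mem_range.1 hr; omega]

/-- The truncation of `h_m` that omits the term with the leading coefficient. -/
noncomputable def hTrunc (k : ℂ) (n : ℕ) (a : ℕ → Holo) (m : ℕ) : Holo :=
  ∑ s ∈ range (n - m), hCoeff k (2 * n - 2 * m) m s •
    (fun g : Holo => Differential.deriv g)^[s] (a (m + s))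

lemma Holo.coe_sum_smul {ι : Type*} (S : Finset ι) (c : ι → ℂ) (F : ι → Holo) (τ : ℍ) :
    ((∑ i ∈ S, c i • F i : Holo) : ℍ → ℂ) τ = ∑ i ∈ S, c i * (F i : ℍ → ℂ) τ := by
  simp

lemma Holo.iterate_deriv_sum_smul {ι : Type*} (S : Finset ι) (c : ι → ℂ) (F : ι → Holo) (i : ℕ) :
    (fun g : Holo => Differential.deriv g)^[i] (∑ s ∈ S, c s • F s) =
      ∑ s ∈ S, c s • (fun g : Holo => Differential.deriv g)^[i] (F s) := by
  induction i with
  | zero => rfl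
  | succ i ih =>
    rw [Function.iterate_succ_apply', ih, map_sum]
    refine sum_congr rfl fun s _ => ?_
    rw [Function.iterate_succ_apply', Algebra.smul_def, Derivation.leibniz, Holo.deriv_algebraMap,
      smul_zero, add_zero, smul_eq_mul, ← Algebra.smul_def]

lemma sum_rankinCohen_hTrunc (k : ℂ) (n : ℕ) (a : ℕ → Holo) (f : ℍ → ℂ) (τ : ℍ) :
    ∑ m ∈ range n, (((2 * n - m - 1).choose m : ℕ) : ℂ)⁻¹ *
        rankinCohen (2 * n - 2 * m) k m (hTrunc k n a m) f τ =
      ∑ r ∈ range n, (a r : ℍ → ℂ) τ * (normalizedDerivOfComplex^[r] f) τ := by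
  have h1 : ∀ m, (((2 * n - m - 1).choose m : ℕ) : ℂ)⁻¹ *
      rankinCohen (2 * n - 2 * m) k m (hTrunc k n a m) f τ =
      ∑ r ∈ range (m + 1), ∑ s ∈ range (n - m),
        bracketCoeff k n m r * hCoeff k (2 * n - 2 * m) m s *
        ((normalizedDerivOfComplex^[m - r + s] (a (m + s))) τ *
          (normalizedDerivOfComplex^[r] f) τ) := by
    intro m
    rw [rankinCohen_eq, mul_sum]
    refine sum_congr rfl fun r _ => ?_
    rw [← Holo.coe_iterate_deriv, hTrunc, Holo.iterate_deriv_sum_smul, Holo.coe_sum_smul, mul_sum,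
      sum_mul, mul_sum]
    refine sum_congr rfl fun s _ => ?_
    rw [← Function.iterate_add_apply, Holo.coe_iterate_deriv, bracketCoeff]
    ring
  simp only [h1]
  rw [sum_comm' (t' := range n) (s' := fun r => Ico r n) (by
    intro m r; simp only [mem_range, mem_Ico]; omega)]
  refine sum_congr rfl fun r hr => ?_
  have hr := mem_range.1 hr
  rw [sum_Ico_eq_sum_range]
  simp only [add_tsub_cancel_left, Nat.sub_add_eq]
  -- With m = r + j, terms are grouped by t = j + s: each group is a scalar times D^t a_{r+t} · D^r
  -- f, and only t = 0 survives.
  rw [← sum_range_diag_flip (n - r) (fun j s => bracketCoeff k n (r + j) r *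
    hCoeff k (2 * n - 2 * (r + j : ℕ)) (r + j) s *
    ((normalizedDerivOfComplex^[j + s] (a (r + j + s))) τ * (normalizedDerivOfComplex^[r] f) τ))]
  have h2 : ∀ t ∈ range (n - r), (∑ j ∈ range (t + 1), bracketCoeff k n (r + j) r *
      hCoeff k (2 * n - 2 * (r + j : ℕ)) (r + j) (t - j) *
      ((normalizedDerivOfComplex^[j + (t - j)] (a (r + j + (t - j)))) τ *
        (normalizedDerivOfComplex^[r] f) τ)) = if t = 0 then
      (a r : ℍ → ℂ) τ * (normalizedDerivOfComplex^[r] f) τ else 0 := by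
    intro t ht
    have ht := mem_range.1 ht
    have h3 := sum_bracketCoeff_mul_hCoeff k n r t (by omega)
    rw [sum_congr rfl (g := fun j => bracketCoeff k n (r + j) r *
      hCoeff k (2 * n - 2 * (r + j : ℕ)) (r + j) (t - j) *
      ((normalizedDerivOfComplex^[t] (a (r + t))) τ * (normalizedDerivOfComplex^[r] f) τ)) ?_,
      ← sum_mul, h3]
    · split_ifs with h
      · subst h; simp
      · simp
    · intro j hj
      have hj := mem_range.1 hj
      rw [show j + (t - j) = t by omega, show r + j + (t - j) = r + t by omega]
  rw [sum_congr rfl h2, sum_ite_eq' (range (n - r)) 0, if_pos (mem_range.2 (by omega))]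

end MLDO

/-! ### Transformation of the coefficients and invariance of h_m. -/

noncomputable section

namespace MLDO

open Finset Complex UpperHalfPlane

lemma normalizedDeriv_exp (c : ℂ) :
    normalizedDerivOfComplex (fun τ : ℍ => cexp (2 * Real.pi * Complex.I * c * τ)) =
      c • fun τ : ℍ => cexp (2 * Real.pi * Complex.I * c * τ) := by
  ext τ
  have h : HasDerivAt (fun z : ℂ => cexp (2 * Real.pi * Complex.I * c * z))
      (cexp (2 * Real.pi * Complex.I * c * τ) * (2 * Real.pi * Complex.I * c)) τ := by
    simpa using ((hasDerivAt_id (τ : ℂ)).const_mul (2 * Real.pi * Complex.I * c)).cexp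
  have h2 : (fun τ : ℍ => cexp (2 * Real.pi * Complex.I * c * τ)) ∘ ofComplex =ᶠ[nhds (τ : ℂ)]
      fun z : ℂ => cexp (2 * Real.pi * Complex.I * c * z) := by
    filter_upwards [isOpen_upperHalfPlaneSet.mem_nhds τ.im_pos] with w hw
    simp only [Function.comp_apply, ofComplex_apply_of_im_pos hw]
  rw [normalizedDerivOfComplex, (h.congr_of_eventuallyEq h2).deriv]
  have := two_pi_I_ne_zero
  simp only [Pi.smul_apply, smul_eq_mul]
  field_simp

lemma mdifferentiable_exp (c : ℂ) :
    MDiff (fun τ : ℍ => cexp (2 * Real.pi * Complex.I * c * τ)) := by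
  rw [UpperHalfPlane.mdifferentiable_iff]
  have h : DifferentiableOn ℂ (fun z : ℂ => cexp (2 * Real.pi * Complex.I * c * z))
      {z | 0 < z.im} := by fun_prop
  refine h.congr fun w hw => ?_
  simp only [Function.comp_apply, ofComplex_apply_of_im_pos hw]

lemma iterate_normalizedDeriv_smul (c : ℂ) {f : ℍ → ℂ} (hf : MDiff f) (i : ℕ) :
    normalizedDerivOfComplex^[i] (c • f) = c • normalizedDerivOfComplex^[i] f := by
  induction i with
  | zero => rfl
  | succ i ih =>
    rw [Function.iterate_succ_apply', ih, normalizedDerivOfComplex_smul _ _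
      (mdifferentiable_iterate_normalizedDeriv hf i), Function.iterate_succ_apply']

lemma iterate_normalizedDeriv_exp (c : ℂ) (i : ℕ) :
    normalizedDerivOfComplex^[i] (fun τ : ℍ => cexp (2 * Real.pi * Complex.I * c * τ)) =
      c ^ i • fun τ : ℍ => cexp (2 * Real.pi * Complex.I * c * τ) := by
  induction i with
  | zero => simp
  | succ i ih =>
    rw [Function.iterate_succ_apply', ih, normalizedDerivOfComplex_smul _ _ (mdifferentiable_exp c),
      normalizedDeriv_exp, smul_smul, pow_succ]

lemma eq_of_sum_mul_pow_eq {N : ℕ} {u v : ℕ → ℂ}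
    (h : ∀ c : ℂ, ∑ j ∈ range N, u j * c ^ j = ∑ j ∈ range N, v j * c ^ j) {j : ℕ} (hj : j < N) :
    u j = v j := by
  have h1 : (∑ j ∈ range N, Polynomial.monomial j (u j)) =
      ∑ j ∈ range N, Polynomial.monomial j (v j) := by
    refine Polynomial.funext fun c => ?_
    simpa [Polynomial.eval_finsetSum] using h c
  have h2 := congrArg (fun p => p.coeff j) h1
  simpa [Polynomial.finsetSum_coeff, Polynomial.coeff_monomial, hj] using h2

namespace DiffOp

/-- The coefficients of a differential operator as elements of the ring of holomorphic
functions. -/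
def holoCoeff (L : DiffOp) (r : ℕ) : Holo := ⟨L.coeff r, L.holomorphic r⟩

variable {L : DiffOp} {n : ℕ}

lemma apply_eq_sum_range (hmonic : L.IsMonicOfOrder n) (f : ℍ → ℂ) (τ : ℍ) :
    L.apply f τ = ∑ r ∈ range (n + 1), L.coeff r τ * (normalizedDerivOfComplex^[r] f) τ := by
  refine Finsupp.sum_of_support_subset _ (fun r hr => ?_) _ (by simp)
  by_contra h
  exact Finsupp.mem_support_iff.1 hr (hmonic.2 r (by simpa using h))

lemma holoCoeff_eq_zero (hmonic : L.IsMonicOfOrder n) (r : ℕ) (hr : n < r) :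
    L.holoCoeff r = 0 := Subtype.ext (hmonic.2 r hr)

/-- Exponentials are eigenfunctions of D with arbitrary eigenvalue c. At a fixed τ, equivariance
becomes an identity of polynomials in c times a common nonzero exponential, so its coefficients
agree. -/
lemma slash_coeff_apply {k : ℂ} (hL : L.IsModular k (k + 2 * n)) (hmonic : L.IsMonicOfOrder n)
    (γ : SL(2, ℤ)) {j : ℕ} (hj : j ≤ n) (τ : ℍ) :
    slash (2 * n - 2 * j) γ (L.coeff j) τ = ∑ r ∈ range (n + 1),
      (r.choose j : ℂ) * (ascPochhammer ℂ (r - j)).eval (k + j) *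
        ((-logFactor γ τ) ^ (r - j) * L.coeff r τ) := by
  have hz := denom_ne_zero γ τ
  set δ := denom γ τ with hδ
  have key : (∑ r ∈ range (n + 1), L.coeff r τ * ((r.choose j : ℂ) *
      (ascPochhammer ℂ (r - j)).eval (k + j) * ((-logFactor γ τ) ^ (r - j)))) *
      δ ^ (-(k + 2 * j)) = δ ^ (-(k + 2 * n)) * L.coeff j (γ • τ) := by
    refine eq_of_sum_mul_pow_eq (N := n + 1) (u := fun j => (∑ r ∈ range (n + 1),
      L.coeff r τ * ((r.choose j : ℂ) * (ascPochhammer ℂ (r - j)).eval (k + j) *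
      ((-logFactor γ τ) ^ (r - j)))) * δ ^ (-(k + 2 * j)))
      (v := fun j => δ ^ (-(k + 2 * n)) * L.coeff j (γ • τ)) (fun c => ?_) (by omega)
    let e : Holo := ⟨_, mdifferentiable_exp c⟩
    have he : (e : ℍ → ℂ) (γ • τ) ≠ 0 := exp_ne_zero _
    have hs := congrFun (hL.equivariant e e.2 γ) τ
    rw [slash, apply_eq_sum_range hmonic, apply_eq_sum_range hmonic] at hs
    have h1 : ∀ r ∈ range (n + 1), L.coeff r τ *
        (normalizedDerivOfComplex^[r] (slash k γ e)) τ = ∑ j ∈ range (n + 1),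
        L.coeff r τ * ((r.choose j : ℂ) * (ascPochhammer ℂ (r - j)).eval (k + j) *
        (-logFactor γ τ) ^ (r - j)) * δ ^ (-(k + 2 * j)) * c ^ j * (e : ℍ → ℂ) (γ • τ) := by
      intro r hr
      have hr := mem_range.1 hr
      have h2 := congrFun (congrArg Subtype.val (Holo.iterate_deriv_slash k γ e r)) τ
      rw [Holo.coe_iterate_deriv, Holo.coe_sum_smul] at h2
      have h3 : (normalizedDerivOfComplex^[r] (slash k γ e)) τ = ∑ j ∈ range (r + 1),
          (r.choose j : ℂ) * (ascPochhammer ℂ (r - j)).eval (k + j) *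
          ((-logFactor γ τ) ^ (r - j) *
            (δ ^ (-(k + 2 * j)) * (c ^ j * (e : ℍ → ℂ) (γ • τ)))) := by
        refine h2.trans (sum_congr rfl fun j _ => ?_)
        have h4 : (((-Holo.logFactor γ) ^ (r - j) * Holo.slash (k + 2 * j) γ
            ((fun g : Holo => Differential.deriv g)^[j] e) : Holo) : ℍ → ℂ) τ =
            (-logFactor γ τ) ^ (r - j) * slash (k + 2 * j) γ
            (((fun g : Holo => Differential.deriv g)^[j] e : Holo) : ℍ → ℂ) τ := rfl
        have h5 : normalizedDerivOfComplex^[j] (e : ℍ → ℂ) = c ^ j • (e : ℍ → ℂ) :=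
          iterate_normalizedDeriv_exp c j
        rw [h4, slash, Holo.coe_iterate_deriv, h5]
        rfl
      rw [h3, mul_sum]
      rw [← sum_subset (range_subset_range.2 (show r + 1 ≤ n + 1 by omega))]
      · refine sum_congr rfl fun j _ => by ring
      · intro j _ hj
        rw [Nat.choose_eq_zero_of_lt (by simpa using hj)]
        simp
    rw [sum_congr rfl h1, sum_comm] at hs
    have h6 : ∀ r, (normalizedDerivOfComplex^[r] (e : ℍ → ℂ)) (γ • τ) =
        c ^ r * (e : ℍ → ℂ) (γ • τ) := fun r =>
      congrFun (iterate_normalizedDeriv_exp c r) (γ • τ)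
    simp only [h6] at hs
    refine mul_right_cancel₀ he ?_
    simp only [sum_mul] at hs ⊢
    rw [hs, mul_sum]
    exact sum_congr rfl fun j _ => by ring
  have hd : δ ^ (-(k + 2 * j)) ≠ 0 := by simp [cpow_eq_zero_iff, hz]
  refine mul_right_cancel₀ hd ?_
  rw [slash, ← hδ, mul_right_comm, ← cpow_add _ _ hz,
    show -(2 * n - 2 * j) + -(k + 2 * j) = -(k + 2 * (n : ℂ)) by ring, ← key]
  congr 1
  exact sum_congr rfl fun r _ => by ring

lemma slash_holoCoeff {k : ℂ} (hL : L.IsModular k (k + 2 * n)) (hmonic : L.IsMonicOfOrder n)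
    (γ : SL(2, ℤ)) {j : ℕ} (hj : j ≤ n) :
    Holo.slash (2 * n - 2 * j) γ (L.holoCoeff j) =
      Polynomial.eval (Holo.logFactor γ) (transPoly k n L.holoCoeff j) := by
  refine Subtype.ext (funext fun τ => ?_)
  rw [eval_transPoly, Holo.coe_sum_smul]
  refine (slash_coeff_apply hL hmonic γ hj τ).trans ?_
  have h1 : ∀ r ∈ range (j + (n + 1)), r ∉ range (n + 1) → (r.choose j : ℂ) *
      (ascPochhammer ℂ (r - j)).eval (k + j) * ((-logFactor γ τ) ^ (r - j) * L.coeff r τ) = 0 := by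
    intro r _ hr
    rw [hmonic.2 r (by simpa using hr)]
    simp
  -- The sum is padded to r ≤ j + n by vanishing a_r, then shifted to r = j + p; indices r < j drop
  -- out through the binomial.
  rw [sum_subset (range_subset_range.2 (by omega)) h1, sum_range_add, sum_eq_zero, zero_add]
  · refine sum_congr rfl fun p _ => ?_
    rw [add_tsub_cancel_left, Nat.choose_symm_add]
    rfl
  · intro r hr
    rw [Nat.choose_eq_zero_of_lt (mem_range.1 hr)]
    simp

/-- The function `h_m` as an element of the ring of holomorphic functions. -/
def holoH (L : DiffOp) (k : ℂ) (n m : ℕ) : Holo :=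
  ∑ s ∈ range (n - m + 1), hCoeff k (2 * n - 2 * m) m s •
    (fun g : Holo => Differential.deriv g)^[s] (L.holoCoeff (m + s))

lemma coe_holoH (L : DiffOp) (k : ℂ) (n m : ℕ) : (L.holoH k n m : ℍ → ℂ) = L.h k (2 * n) n m := by
  ext τ
  rw [holoH, Holo.coe_sum_smul]
  refine sum_congr rfl fun s _ => ?_
  rw [Holo.coe_iterate_deriv]
  rfl

lemma slash_holoH {k : ℂ} (hL : L.IsModular k (k + 2 * n)) (hmonic : L.IsMonicOfOrder n)
    (γ : SL(2, ℤ)) {m : ℕ} (hm : m + 2 ≤ n) :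
    Holo.slash (2 * n - 2 * m) γ (L.holoH k n m) = L.holoH k n m := by
  obtain ⟨M, rfl⟩ := Nat.exists_eq_add_of_le (show m ≤ n by omega)
  -- Here m ≤ n - 2 is essential: for M = n - m = 1 and s = 0 the expression is 0.
  have hW : ∀ s : ℕ, s < M → (2 * (m + M : ℕ) - 2 * m : ℂ) - s - 2 ≠ 0 := by
    intro s hs h
    have h1 : ((2 * M : ℕ) : ℂ) = ((s + 2 : ℕ) : ℂ) := by push_cast at h ⊢; linear_combination h
    have h2 : 2 * M = s + 2 := Nat.cast_injective h1
    omega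
  have h := sum_hCoeff_smul_nablaIter Holo.deriv_algebraMap (Holo.deriv_logFactor γ) k
    (2 * (m + M : ℕ) - 2 * m) m M (holoCoeff_eq_zero hmonic) hW
  rw [holoH, add_tsub_cancel_left]
  have h2 : ∀ (w : ℂ) (c : ℕ → ℂ) (F : ℕ → Holo), Holo.slash w γ (∑ s ∈ range (M + 1), c s • F s) =
      ∑ s ∈ range (M + 1), c s • Holo.slash w γ (F s) := by
    intro w c F
    refine Subtype.ext (funext fun τ => ?_)
    rw [Holo.coe_sum_smul]
    change denom γ τ ^ (-w) * _ = _
    rw [Holo.coe_sum_smul, mul_sum]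
    exact sum_congr rfl fun s _ => mul_left_comm _ _ _
  rw [h2, ← h]
  refine sum_congr rfl fun s hs => ?_
  have hs := mem_range.1 hs
  rw [← slash_holoCoeff hL hmonic γ (by omega),
    show (2 * (m + M : ℕ) - 2 * (m + s : ℕ) : ℂ) = 2 * (m + M : ℕ) - 2 * m - 2 * s by
      push_cast; ring, ← Holo.slash_iterate_deriv, sub_add_cancel]

end DiffOp

end MLDO

end

/-! ### The leftover bracket and the final expansion. -/

namespace MLDO

open Finset Complex UpperHalfPlane

namespace DiffOp

variable {L : DiffOp} {n : ℕ}

lemma isBoundedAtImInfty_holoH {k l : ℂ} (hL : L.IsModular k l) (k' : ℂ) (n m : ℕ) :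
    IsBoundedAtImInfty (L.holoH k' n m : ℍ → ℂ) := by
  have h : (L.holoH k' n m : ℍ → ℂ) = ∑ s ∈ range (n - m + 1), hCoeff k' (2 * n - 2 * m) m s •
      normalizedDerivOfComplex^[s] (L.coeff (m + s)) := by
    ext τ
    rw [holoH, Holo.coe_sum_smul, Finset.sum_apply]
    refine sum_congr rfl fun s _ => ?_
    rw [Holo.coe_iterate_deriv]
    rfl
  rw [h]
  exact (boundedAtImInftySubalgebra ℂ).sum_mem fun s _ =>
    (boundedAtImInftySubalgebra ℂ).smul_mem
      (isBoundedAtImInfty_iterate_normalizedDeriv (L.holomorphic _) (hL.bounded _) s) _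

/-- The second highest coefficient of a monic modular operator is a multiple of `E₂`. -/
lemma coeff_pred_eq {k : ℂ} (hL : L.IsModular k (k + 2 * (n + 1 : ℕ)))
    (hmonic : L.IsMonicOfOrder (n + 1)) :
    L.coeff n = (-((n + 1) * (k + n) / 12) : ℂ) • E2 := by
  have hE : MDiff E2 := E2_mdifferentiable
  have hs : MDiff (L.coeff n + ((n + 1) * (k + n) / 12 : ℂ) • E2) :=
    Holo.add_mem (L.holomorphic n) (Holo.smul_mem hE _)
  have hb : IsBoundedAtImInfty (L.coeff n + ((n + 1) * (k + n) / 12 : ℂ) • E2) :=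
    (boundedAtImInftySubalgebra ℂ).add_mem (hL.bounded n)
      ((boundedAtImInftySubalgebra ℂ).smul_mem isBoundedAtImInfty_E2 _)
  -- Slashing adds -(n+1)(k+n)x to the coefficient and 12x to `E2`, so the anomalies cancel in this
  -- combination of weight 2.
  have h0 := eq_zero_of_weight_two hs hb fun γ => by
    ext τ
    have h1 := slash_coeff_apply hL hmonic γ (Nat.le_succ n) τ
    have h2 := congrFun (slash_E2 γ) τ
    rw [sum_range_succ, sum_range_succ, sum_eq_zero, zero_add, hmonic.1] at h1
    · rw [show (2 * (n + 1 : ℕ) - 2 * n : ℂ) = 2 by push_cast; ring] at h1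
      simp only [slash, Pi.add_apply, Pi.smul_apply, smul_eq_mul, Pi.one_apply, tsub_self,
        ascPochhammer_zero, Polynomial.eval_one, pow_zero, Nat.choose_self, Nat.cast_one,
        add_tsub_cancel_left, ascPochhammer_one, Polynomial.eval_X, pow_one, mul_one, one_mul,
        Nat.choose_succ_self_right] at h1 h2 ⊢
      push_cast at h1
      linear_combination h1 + (n + 1) * (k + n) / 12 * h2
    · intro r hr
      rw [Nat.choose_eq_zero_of_lt (mem_range.1 hr)]
      simp
  ext τ
  have h1 := congrFun h0 τ
  simp only [Pi.add_apply, Pi.smul_apply, smul_eq_mul, Pi.zero_apply] at h1 ⊢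
  linear_combination h1

lemma hTrunc_pred (L : DiffOp) (k : ℂ) (n : ℕ) :
    (hTrunc k (n + 1) L.holoCoeff n : ℍ → ℂ) = L.coeff n := by
  ext τ
  rw [hTrunc, Holo.coe_sum_smul, show n + 1 - n = 1 by omega]
  simp [hCoeff, holoCoeff]

/-- The omitted term is a positive-order derivative of the leading coefficient 1. -/
lemma hTrunc_eq_h (hmonic : L.IsMonicOfOrder n) (k : ℂ) {m : ℕ} (hm : m < n) :
    (hTrunc k n L.holoCoeff m : ℍ → ℂ) = L.h k (2 * n) n m := by
  rw [← coe_holoH, holoH, hTrunc, sum_range_succ, show m + (n - m) = n by omega]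
  have h1 : L.holoCoeff n = 1 := Subtype.ext hmonic.1
  have h2 : ∀ s, (fun g : Holo => Differential.deriv g)^[s + 1] 1 = 0 := fun s => by
    induction s with
    | zero => simp
    | succ s ih => rw [Function.iterate_succ_apply', ih, map_zero]
  obtain ⟨s, hs⟩ := Nat.exists_eq_succ_of_ne_zero (show n - m ≠ 0 by omega)
  rw [h1, hs, Nat.succ_eq_add_one, h2, smul_zero, add_zero]

end DiffOp

lemma rankinCohen_smul (k l c : ℂ) (m : ℕ) {g : ℍ → ℂ} (hg : MDiff g) (f : ℍ → ℂ) (τ : ℍ) :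
    rankinCohen k l m (c • g) f τ = c * rankinCohen k l m g f τ := by
  rw [rankinCohen, rankinCohen, mul_sum]
  refine sum_congr rfl fun i _ => ?_
  rw [iterate_normalizedDeriv_smul c hg, Pi.smul_apply, smul_eq_mul]
  ring

/-- The factor n + 1 in the subleading coefficient cancels against the binomial normalization,
leaving the constant (k+n)/12. -/
lemma kanekoKoike_succ_eq {k : ℂ} {n : ℕ} {L : DiffOp} (hL : L.IsModular k (k + 2 * (n + 1 : ℕ)))
    (hmonic : L.IsMonicOfOrder (n + 1)) (f : ℍ → ℂ) (τ : ℍ) :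
    kanekoKoike k (n + 1) f τ = (normalizedDerivOfComplex^[n + 1] f) τ +
      (((2 * (n + 1) - n - 1).choose n : ℕ) : ℂ)⁻¹ *
        rankinCohen (2 * (n + 1 : ℕ) - 2 * n) k n (L.coeff n) f τ := by
  have hn : (n + 1 : ℂ) ≠ 0 := Nat.cast_add_one_ne_zero n
  rw [kanekoKoike, DiffOp.coeff_pred_eq hL hmonic, rankinCohen_smul _ _ _ _ E2_mdifferentiable,
    show 2 * (n + 1) - n - 1 = n + 1 by omega, Nat.choose_succ_self_right,
    show (2 * (n + 1 : ℕ) - 2 * n : ℂ) = 2 by push_cast; ring]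
  push_cast
  field_simp
  ring

end MLDO

theorem mainTheorem9 (k : ℂ) (n : ℕ) (L : MLDO.DiffOp)
    (hL : L.IsModular k (k + 2 * n)) (hmonic : L.IsMonicOfOrder n) :
    (∀ m : ℕ, m + 2 ≤ n →
      ∃ g : ModularForm 𝒮ℒ (2 * (n : ℤ) - 2 * (m : ℤ)), ∀ τ : ℍ, g τ = L.h k (2 * n) n m τ) ∧
    ∀ f : ℍ → ℂ, MDiff f → ∀ τ : ℍ,
      L.apply f τ = MLDO.kanekoKoike k n f τ +
        ∑ m ∈ Finset.range (n - 1),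
          (((2 * n - m - 1).choose m : ℕ) : ℂ)⁻¹ *
            MLDO.rankinCohen (2 * n - 2 * m) k m (L.h k (2 * n) n m) f τ := by
  refine ⟨fun m hm => ?_, fun f _ τ => ?_⟩
  · rw [← MLDO.DiffOp.coe_holoH]
    refine MLDO.exists_modularForm (L.holoH k n m).2
      (MLDO.DiffOp.isBoundedAtImInfty_holoH hL k n m) fun γ => ?_
    have h := congrArg Subtype.val (MLDO.DiffOp.slash_holoH hL hmonic γ hm)
    push_cast
    exact h
  · rw [MLDO.DiffOp.apply_eq_sum_range hmonic]
    rcases n with _ | n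
    · simp [MLDO.kanekoKoike, hmonic.1]
    · rw [Finset.sum_range_succ, hmonic.1, MLDO.kanekoKoike_succ_eq hL hmonic]
      have h := MLDO.sum_rankinCohen_hTrunc k (n + 1) L.holoCoeff f τ
      -- The top bracket, formed with the subleading coefficient, is split off for the Kaneko–Koike
      -- operator; in the others `hTrunc` may be replaced by `h`.
      rw [Finset.sum_range_succ, MLDO.DiffOp.hTrunc_pred] at h
      have h1 : ∑ r ∈ Finset.range (n + 1), L.coeff r τ * (normalizedDerivOfComplex^[r] f) τ =
          ∑ r ∈ Finset.range (n + 1),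
            (L.holoCoeff r : ℍ → ℂ) τ * (normalizedDerivOfComplex^[r] f) τ := rfl
      rw [h1, ← h, Pi.one_apply, one_mul, add_tsub_cancel_right, Finset.sum_congr rfl
        fun m hm => by rw [MLDO.DiffOp.hTrunc_eq_h hmonic k (m := m) (by
          have := Finset.mem_range.1 hm; omega)]]
      ring
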